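/- Conventions. A \emph{continuous field of Hilbert spaces} over a topological space $X$ is a family $\mathcal H=((H_x)_{x\in X},\Gamma)$, where each $H_x$ is a complex Hilbert space and $\Gamma\subseteq\prod_{x\in X}H_x$ is a linear subspace such that (1) $x\mapsto\|\xi(x)\|$ is continuous for every $\xi\in\Gamma$; (2) $\{\xi(x):\xi\in\Gamma\}$ is dense in $H_x$ for every $x$; (3) if $\xi\in\prod_x H_x$ and for all $x\in X$, $\varepsilon>0$ there is $\eta\in\Gamma$ with $\|\xi(y)-\eta(y)\|\le\varepsilon$ for all $y$ in a neighbourhood of $x$, then $\xi\in\Gamma$. A \emph{subfield} of $\mathcal H$ is a continuous field $((H'_x)_x,\Gamma')$ with $H'_x$ a closed subspace of $H_x$ and $\Gamma'\subseteq\Gamma$. A field is \emph{trivial of rank $n$} if there are unitary maps $H_x\to\mathbb C^n$ $(x\in X)$ that carry $\Gamma$ onto the set of all continuous maps $X\to\mathbb C^n$. The covering dimension satisfies $\dim X\le 1$ if every open cover of $X$ has an open refinement (again a cover) such that each point lies in at most two of its members. Let $X$ be a separable metric space with covering dimension $\dim X\le 1$, and let $n\ge 0$ be an integer. (a) If $\mathcal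 H$ is a continuous field of Hilbert spaces over $X$ such that $\dim H_x\ge n$ for every $x\in X$, then $\mathcal H$ has a trivial subfield of rank $n$. (b) Let $H$ be a complex Hilbert space and let $p:X\to B(H)$ be a strongly continuous function whose values are (orthogonal) projections. If $\operatorname{rank}(p(x))\ge n$ for every $x\in X$, then there is a norm continuous function $q:X\to B(H)$ whose values are projections, such that $q(x)\le p(x)$ and $\operatorname{rank}(q(x))=n$ for every $x\in X$. The two assertions are equivalent for the field defined by $p$: for every strongly continuous projection-valued $p:X\to B(H)$, the continuous field with fibers $p(x)H$, whose continuous vector fields are the continuous maps $\xi:X\to H$ with $\xi(x)\in p(x)H$ for all $x$, has a trivial subfield of rank $n$ if and only if there is a function $q$ as in (b). -/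

import Mathlib

/-- `CoveringDimLE X d`: the covering dimension of `X` is at most `d`, i.e. every open cover of `X`
has an open refinement, again a cover, such that each point lies in at most `d + 1` members. -/
def CoveringDimLE (X : Type*) [TopologicalSpace X] (d : ℕ) : Prop :=
  ∀ U : Set (Set X), (∀ A ∈ U, IsOpen A) → ⋃₀ U = Set.univ →
    ∃ V : Set (Set X), (∀ B ∈ V, IsOpen B) ∧ ⋃₀ V = Set.univ ∧
      (∀ B ∈ V, ∃ A ∈ U, B ⊆ A) ∧ ∀ x : X, {B ∈ V | x ∈ B}.encard ≤ (d : ℕ∞) + 1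

/-- A continuous field of (complex) Hilbert spaces over `X` with fibers `E x`: a linear space
of vector fields (the continuous vector fields) with continuous norms, with dense values in
every fiber, and containing every vector field that it approximates locally uniformly. -/
structure HilbertField (X : Type*) [TopologicalSpace X] (E : X → Type*)
    [∀ x, NormedAddCommGroup (E x)] [∀ x, InnerProductSpace ℂ (E x)] where
  complete : ∀ x, CompleteSpace (E x)
  sections : Submodule ℂ (∀ x, E x)
  continuous_norm : ∀ ξ ∈ sections, Continuous fun x => ‖ξ x‖
  dense_values : ∀ x, Dense {v : E x | ∃ ξ ∈ sections, ξ x = v}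
  mem_of_locally_approx : ∀ ξ : (∀ x, E x),
    (∀ x, ∀ ε : ℝ, 0 < ε → ∃ η ∈ sections, ∀ᶠ y in nhds x, ‖ξ y - η y‖ ≤ ε) → ξ ∈ sections

namespace HilbertField

/-- A function into a normed space that is locally uniformly approximated by continuous functions
is continuous. -/
theorem continuous_of_locally_approx {X K : Type*} [TopologicalSpace X] [NormedAddCommGroup K]
    (ξ : X → K)
    (h : ∀ x, ∀ ε : ℝ, 0 < ε → ∃ η : X → K, Continuous η ∧ ∀ᶠ y in nhds x, ‖ξ y - η y‖ ≤ ε) :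
    Continuous ξ := by
  rw [continuous_iff_continuousAt]
  intro x
  rw [ContinuousAt, Metric.tendsto_nhds]
  intro ε hε
  obtain ⟨η, hη, hx⟩ := h x (ε / 4) (by positivity)
  have h1 := Metric.tendsto_nhds.1 (hη.tendsto x) (ε / 4) (by positivity)
  filter_upwards [hx, h1] with y hy h2
  have h3 := hx.self_of_nhds
  rw [dist_eq_norm] at h2 ⊢
  calc ‖ξ y - ξ x‖ = ‖(ξ y - η y) + (η y - η x) - (ξ x - η x)‖ := by congr 1; abel
    _ ≤ ‖ξ y - η y‖ + ‖η y - η x‖ + ‖ξ x - η x‖ :=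
        (norm_sub_le _ _).trans (by gcongr; exact norm_add_le _ _)
    _ < ε := by linarith

/-- The constant field over `X` defined by the Hilbert space `K`: its continuous vector fields are
all the continuous maps from `X` to `K`. -/
def const (X : Type*) [TopologicalSpace X] (K : Type*) [NormedAddCommGroup K]
    [InnerProductSpace ℂ K] [CompleteSpace K] : HilbertField X (fun _ => K) where
  complete := fun _ => inferInstance
  sections :=
    { carrier := {ξ | Continuous ξ}
      add_mem' := fun ha hb => Continuous.add ha hb
      zero_mem' := continuous_const
      smul_mem' := fun c _ ha => Continuous.const_smul ha c }
  continuous_norm := fun _ hξ => Continuous.norm hξ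
  dense_values := fun _ => by
    refine dense_univ.mono fun v _ => ⟨fun _ => v, ?_, rfl⟩
    exact continuous_const
  mem_of_locally_approx := fun ξ h => continuous_of_locally_approx ξ h

/-- (Isometric) isomorphism of continuous fields: unitary maps of the fibers that carry the
continuous vector fields of the one onto those of the other. -/
def Isomorphic {X : Type*} [TopologicalSpace X] {E E' : X → Type*}
    [∀ x, NormedAddCommGroup (E x)] [∀ x, InnerProductSpace ℂ (E x)]
    [∀ x, NormedAddCommGroup (E' x)] [∀ x, InnerProductSpace ℂ (E' x)]
    (F : HilbertField X E) (F' : HilbertField X E') : Prop :=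
  ∃ φ : ∀ x, E x ≃ₗᵢ[ℂ] E' x,
    ∀ ξ : (∀ x, E x), ξ ∈ F.sections ↔ (fun x => φ x (ξ x)) ∈ F'.sections

/-- A trivial field of rank `n`: one that is isomorphic to the constant field defined by an
`n`-dimensional Hilbert space. -/
def IsTrivialOfRank {X : Type*} [TopologicalSpace X] {E : X → Type*}
    [∀ x, NormedAddCommGroup (E x)] [∀ x, InnerProductSpace ℂ (E x)]
    (F : HilbertField X E) (n : ℕ) : Prop :=
  F.Isomorphic (const X (EuclideanSpace ℂ (Fin n)))

/-- A subfield of a continuous field: a continuous field whose fibers are closed subspaces of the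
given fibers and whose continuous vector fields are continuous vector fields of the given field.
(The fibers are complete by `HilbertField.complete`, hence closed.) -/
structure SubHilbertField {X : Type*} [TopologicalSpace X] {E : X → Type*}
    [∀ x, NormedAddCommGroup (E x)] [∀ x, InnerProductSpace ℂ (E x)]
    (F : HilbertField X E) where
  fiber : ∀ x, Submodule ℂ (E x)
  field : HilbertField X (fun x => fiber x)
  sections_subset : ∀ ξ ∈ field.sections, (fun x => (ξ x : E x)) ∈ F.sections

/-- The field has a trivial subfield of rank `n`. -/
def HasTrivialSubfield {X : Type*} [TopologicalSpace X] {E : X → Type*}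
    [∀ x, NormedAddCommGroup (E x)] [∀ x, InnerProductSpace ℂ (E x)]
    (F : HilbertField X E) (n : ℕ) : Prop :=
  ∃ S : F.SubHilbertField, S.field.IsTrivialOfRank n

/-- The continuous field defined by a strongly continuous projection-valued function `p`: the fiber
at `x` is the range of `p x`, and the continuous vector fields are the continuous maps `ξ` to `H`
with `ξ x` in the range of `p x` for all `x`. -/
def ofProjection {X : Type*} [TopologicalSpace X] {H : Type*} [NormedAddCommGroup H]
    [InnerProductSpace ℂ H] [CompleteSpace H] (p : X → H →L[ℂ] H)
    (hp : ∀ x, IsStarProjection (p x)) (hcont : ∀ v : H, Continuous fun x => p x v) :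
    HilbertField X (fun x => (p x).range) where
  complete := fun x => by
    have h : IsClosed ((p x).range : Set H) :=
      ContinuousLinearMap.IsIdempotentElem.isClosed_range (hp x).isIdempotentElem
    exact h.completeSpace_coe
  sections :=
    { carrier := {ξ | Continuous fun x => (ξ x : H)}
      add_mem' := fun ha hb => Continuous.add ha hb
      zero_mem' := continuous_const
      smul_mem' := fun c _ ha => Continuous.const_smul ha c }
  continuous_norm := fun _ hξ => Continuous.norm hξ
  dense_values := fun x => by
    refine dense_univ.mono ?_
    rintro ⟨_, v, rfl⟩ _
    exact ⟨fun y => ⟨p y v, v, rfl⟩, hcont v, rfl⟩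
  mem_of_locally_approx := fun ξ h => continuous_of_locally_approx (fun x => (ξ x : H))
    fun x ε hε => by
      obtain ⟨η, hη, hx⟩ := h x ε hε
      exact ⟨fun y => (η y : H), hη, hx⟩

end HilbertField

/-! A trivial subfield of rank n amounts to n continuous vector fields that are orthonormal at every
point. Such a frame is built one field at a time, each step needing a nowhere vanishing field
orthogonal to those already found; this exists by `exists_nowhere_vanishing`.

Dimension at most one enters through `CoveringDimLE.exists_nonvanishing`. A cover by three sets
shrinks to one without triple points, so a subordinate partition of unity maps X into the boundary
of a triangle around 0 in ℂ. With f = ⟨ζ, ξ⟩, this gives a small multiple of ζ that keeps ξ away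
from 0 wherever ζ is large. Countably many such corrections, each small against the lower bounds
already secured, converge to the required field.

For (b), a frame of the field of p spans the range of q. -/

/-! ### Nonvanishing functions in dimension at most one -/

/-- A cover by three open sets of a space of covering dimension at most one can be shrunk to a
cover by three open sets without common point. -/
theorem CoveringDimLE.exists_shrink_three {X : Type*} [TopologicalSpace X]
    (hX : CoveringDimLE X 1) (O : Fin 3 → Set X) (hO : ∀ i, IsOpen (O i))
    (hcov : ∀ x, ∃ i, x ∈ O i) :
    ∃ W : Fin 3 → Set X, (∀ i, IsOpen (W i)) ∧ (∀ i, W i ⊆ O i) ∧ (∀ x, ∃ i, x ∈ W i) ∧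
      ∀ x, ∃ i, x ∉ W i := by
  obtain ⟨V, hVo, hVc, hVr, hV⟩ := hX (Set.range O) (by rintro _ ⟨i, rfl⟩; exact hO i)
    (Set.eq_univ_of_forall fun x => by
      obtain ⟨i, hi⟩ := hcov x
      exact ⟨_, ⟨i, rfl⟩, hi⟩)
  have hidx : ∀ B : V, ∃ i, B.1 ⊆ O i := fun B => by
    obtain ⟨_, ⟨i, rfl⟩, h⟩ := hVr B.1 B.2
    exact ⟨i, h⟩
  choose c hc using hidx
  -- The members of the refinement are grouped by a chosen index. A point of all three unions would
  -- lie in three members, distinct because their indices differ.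
  refine ⟨fun i => ⋃ B : {B : V // c B = i}, B.1.1,
    fun i => isOpen_iUnion fun B => hVo _ B.1.2, fun i => ?_, fun x => ?_, fun x => ?_⟩
  · rintro x hx
    obtain ⟨⟨B, rfl⟩, hB⟩ := Set.mem_iUnion.1 hx
    exact hc B hB
  · obtain ⟨B, hB, hx⟩ := Set.mem_sUnion.1 (hVc ▸ Set.mem_univ x)
    exact ⟨c ⟨B, hB⟩, Set.mem_iUnion.2 ⟨⟨⟨B, hB⟩, rfl⟩, hx⟩⟩
  · by_contra! h
    have h' : ∀ i, ∃ B : V, c B = i ∧ x ∈ B.1 := fun i => by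
      obtain ⟨⟨B, hB⟩, hx⟩ := Set.mem_iUnion.1 (h i)
      exact ⟨B, hB, hx⟩
    choose B hB hxB using h'
    have hinj : Function.Injective fun i => (B i).1 := fun i j hij => by
      rw [← hB i, ← hB j, Subtype.ext hij]
    have h3 : (Set.range fun i => (B i).1).encard = 3 := by
      rw [← Set.image_univ, hinj.encard_image, Set.encard_univ]
      simp
    have hsub : (Set.range fun i => (B i).1) ⊆ {B ∈ V | x ∈ B} := by
      rintro _ ⟨i, rfl⟩
      exact ⟨(B i).2, hxB i⟩
    have h4 := (Set.encard_le_encard hsub).trans (hV x)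
    rw [h3] at h4
    norm_num at h4

/-- Over a normal space of covering dimension at most one, every complex function admits a
function that is bounded away from zero and nowhere points away from it, up to a given positive
error function. -/
theorem CoveringDimLE.exists_nonvanishing {X : Type*} [TopologicalSpace X] [NormalSpace X]
    (hX : CoveringDimLE X 1) {f : X → ℂ} (hf : Continuous f) {s : X → ℝ} (hs : Continuous s)
    (hs0 : ∀ x, 0 < s x) :
    ∃ h : X → ℂ, Continuous h ∧ (∀ x, 1 / 5 ≤ ‖h x‖ ^ 2) ∧ (∀ x, ‖h x‖ ≤ 2) ∧
      ∀ x, -s x < (h x).re * (f x).re + (h x).im * (f x).im := by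
  have hre : Continuous fun x => (f x).re := Complex.continuous_re.comp hf
  have him : Continuous fun x => (f x).im := Complex.continuous_im.comp hf
  -- Real inner products of f with the vertices (1,0), (-1,1), (-1,-1) of a triangle around 0. Since
  -- 2g₀ + g₁ + g₂ = 0, they cannot all be at most -s.
  set g : Fin 3 → X → ℝ :=
    ![fun x => (f x).re, fun x => (f x).im - (f x).re, fun x => -(f x).im - (f x).re] with hg
  have hgc : ∀ i, Continuous (g i) := by
    intro i
    fin_cases i
    · exact hre
    · exact him.sub hre
    · exact him.neg.sub hre
  obtain ⟨W, hWo, hWO, hWc, hW⟩ := hX.exists_shrink_three (fun i => {x | -s x < g i x})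
    (fun i => isOpen_lt hs.neg (hgc i)) (fun x => by
      by_contra! h
      have h0 : (f x).re ≤ -s x := not_lt.1 (h 0)
      have h1 : (f x).im - (f x).re ≤ -s x := not_lt.1 (h 1)
      have h2 : -(f x).im - (f x).re ≤ -s x := not_lt.1 (h 2)
      have := hs0 x
      linarith)
  obtain ⟨φ, hφ⟩ := PartitionOfUnity.exists_isSubordinate_of_locallyFinite isClosed_univ W hWo
    (locallyFinite_of_finite _) (fun x _ => Set.mem_iUnion.2 (hWc x))
  have hsum : ∀ x, φ 0 x + φ 1 x + φ 2 x = 1 := fun x => by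
    have := φ.sum_eq_one (Set.mem_univ x)
    rwa [finsum_eq_sum_of_fintype, Fin.sum_univ_three] at this
  have hnn : ∀ i x, 0 ≤ φ i x := fun i x => φ.nonneg i x
  have hmem : ∀ i x, φ i x ≠ 0 → x ∈ W i := fun i x hx =>
    hφ i (subset_tsupport _ hx)
  have hzero : ∀ x, φ 0 x = 0 ∨ φ 1 x = 0 ∨ φ 2 x = 0 := fun x => by
    by_contra! h
    obtain ⟨i, hi⟩ := hW x
    refine hi (hmem i x ?_)
    fin_cases i
    exacts [h.1, h.2.1, h.2.2]
  have hn : ∀ x, ‖(⟨φ 0 x - φ 1 x - φ 2 x, φ 1 x - φ 2 x⟩ : ℂ)‖ ^ 2 =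
      (φ 0 x - φ 1 x - φ 2 x) ^ 2 + (φ 1 x - φ 2 x) ^ 2 := fun x => by
    rw [← Complex.normSq_eq_norm_sq, Complex.normSq_mk]
    ring
  -- The average of the vertices with weights φᵢ. Some weight vanishes, so it lies on the boundary
  -- of the triangle, whose squared distance from 0 is 1/5.
  refine ⟨fun x => ⟨φ 0 x - φ 1 x - φ 2 x, φ 1 x - φ 2 x⟩, ?_, fun x => ?_, fun x => ?_,
    fun x => ?_⟩
  · have : Continuous fun x => (((φ 0 x - φ 1 x - φ 2 x : ℝ) : ℂ) +
        ((φ 1 x - φ 2 x : ℝ) : ℂ) * Complex.I) := by fun_prop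
    convert this using 2 with x
    exact Complex.mk_eq_add_mul_I _ _
  · rw [hn]
    have h1 := hsum x
    rcases hzero x with h | h | h
    · rw [h] at h1 ⊢
      nlinarith [sq_nonneg (φ 1 x - φ 2 x)]
    · have h2 : φ 0 x = 1 - φ 2 x := by linarith
      rw [h, h2]
      nlinarith [sq_nonneg (5 * φ 2 x - 2)]
    · have h2 : φ 0 x = 1 - φ 1 x := by linarith
      rw [h, h2]
      nlinarith [sq_nonneg (5 * φ 1 x - 2)]
  · refine abs_le_of_sq_le_sq' ?_ (by norm_num) |>.2
    rw [hn]
    have h1 := hsum x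
    have := hnn 0 x
    have := hnn 1 x
    have := hnn 2 x
    have h2 : (φ 0 x - φ 1 x - φ 2 x) ^ 2 ≤ 1 := by
      rw [sq_le_one_iff_abs_le_one, abs_le]
      constructor <;> linarith
    have h3 : (φ 1 x - φ 2 x) ^ 2 ≤ 1 := by
      rw [sq_le_one_iff_abs_le_one, abs_le]
      constructor <;> linarith
    linarith
  -- The inner product of h with f is the average of the gᵢ, and gᵢ > -s wherever φᵢ ≠ 0.
  · have key : ∀ i, φ i x * (-s x) ≤ φ i x * g i x := fun i => by
      rcases (hnn i x).eq_or_lt' with h | h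
      · simp [h]
      · exact mul_le_mul_of_nonneg_left (hWO i (hmem i x h.ne')).le h.le
    have key' : ∃ i, φ i x * (-s x) < φ i x * g i x := by
      by_contra! hcon
      have hz : ∀ i, φ i x = 0 := fun i => by
        by_contra h
        have hpos := (hnn i x).lt_of_ne' h
        exact absurd (mul_lt_mul_of_pos_left (hWO i (hmem i x h)) hpos) (hcon i).not_gt
      have := hsum x
      rw [hz, hz, hz] at this
      norm_num at this
    have hlt : ∑ i, φ i x * (-s x) < ∑ i, φ i x * g i x := by
      obtain ⟨i, hi⟩ := key'
      exact Finset.sum_lt_sum (fun i _ => key i) ⟨i, Finset.mem_univ _, hi⟩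
    rw [← Finset.sum_mul, Fin.sum_univ_three, Fin.sum_univ_three, hsum, one_mul] at hlt
    refine hlt.trans_eq ?_
    simp only [hg, Matrix.cons_val_zero, Matrix.cons_val_one, Matrix.cons_val]
    ring

/-! ### Nowhere vanishing vector fields -/

namespace HilbertField

section

variable {X : Type*} [TopologicalSpace X] {E : X → Type*}
  [∀ x, NormedAddCommGroup (E x)] [∀ x, InnerProductSpace ℂ (E x)]

/-- Near x the product is uniformly close to the constant multiple f(x)ξ, so local completeness
applies. -/
theorem smul_mem_sections (F : HilbertField X E) {f : X → ℂ} (hf : Continuous f)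
    {ξ : ∀ x, E x} (hξ : ξ ∈ F.sections) : (fun x => f x • ξ x) ∈ F.sections := by
  refine F.mem_of_locally_approx _ fun x ε hε => ⟨f x • ξ, F.sections.smul_mem _ hξ, ?_⟩
  have hc : Continuous fun y => ‖f y - f x‖ * ‖ξ y‖ :=
    (hf.sub continuous_const).norm.mul (F.continuous_norm ξ hξ)
  have h := hc.tendsto x
  simp only [sub_self, norm_zero, zero_mul] at h
  filter_upwards [h.eventually_le_const hε] with y hy
  rwa [Pi.smul_apply, ← sub_smul, norm_smul]

theorem continuous_inner (F : HilbertField X E) {ξ η : ∀ x, E x} (hξ : ξ ∈ F.sections)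
    (hη : η ∈ F.sections) : Continuous fun x => inner ℂ (ξ x) (η x) := by
  simp only [inner_eq_sum_norm_sq_div_four]
  have hI := F.sections.smul_mem (RCLike.I : ℂ) hη
  have h1 := F.continuous_norm _ (F.sections.add_mem hξ hη)
  have h2 := F.continuous_norm _ (F.sections.sub_mem hξ hη)
  have h3 := F.continuous_norm _ (F.sections.sub_mem hξ hI)
  have h4 := F.continuous_norm _ (F.sections.add_mem hξ hI)
  simp only [Pi.add_apply, Pi.sub_apply, Pi.smul_apply] at h1 h2 h3 h4
  refine Continuous.div_const (Continuous.add (Continuous.sub ?_ ?_)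
    (Continuous.mul (Continuous.sub ?_ ?_) continuous_const)) _
  exacts [(Complex.continuous_ofReal.comp h1).pow 2, (Complex.continuous_ofReal.comp h2).pow 2,
    (Complex.continuous_ofReal.comp h3).pow 2, (Complex.continuous_ofReal.comp h4).pow 2]

/-- A vector field can be perturbed to be nonzero where a given one is large, if the covering
dimension of the base is at most one. -/
theorem exists_perturbation [NormalSpace X] (hX : CoveringDimLE X 1) (F : HilbertField X E)
    {ξ ζ : ∀ x, E x} (hξ : ξ ∈ F.sections) (hζ : ζ ∈ F.sections) (hζ1 : ∀ x, ‖ζ x‖ ≤ 1)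
    {s : X → ℝ} (hs : Continuous s) (hs0 : ∀ x, 0 < s x) :
    ∃ g : X → ℂ, Continuous g ∧ (∀ x, ‖g x • ζ x‖ ≤ s x / 4) ∧
      ∀ x, 1 / 2 ≤ ‖ζ x‖ → ξ x + g x • ζ x ≠ 0 := by
  -- With g = (s/8)h, a zero of ξ + gζ gives h·⟨ζ, ξ⟩ = -(s/8)‖ζ‖²|h|² as a real inner product.
  -- Where ‖ζ‖ ≥ 1/2 this is at most -(s/8)(1/4)(1/5) = -s/160.
  obtain ⟨h, hc, hlow, hup, hre⟩ := hX.exists_nonvanishing (F.continuous_inner hζ hξ)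
    (hs.div_const 160) (fun x => div_pos (hs0 x) (by norm_num))
  refine ⟨fun x => ((s x / 8 : ℝ) : ℂ) * h x,
    (Complex.continuous_ofReal.comp (hs.div_const 8)).mul hc, fun x => ?_, fun x hx h0 => ?_⟩
  · have := hs0 x
    rw [norm_smul, norm_mul, Complex.norm_real, Real.norm_of_nonneg (by positivity)]
    calc s x / 8 * ‖h x‖ * ‖ζ x‖ ≤ s x / 8 * 2 * 1 := by
          gcongr
          exacts [hup x, hζ1 x]
      _ = s x / 4 := by ring
  · have h1 : inner ℂ (ζ x) (ξ x) = -(((s x / 8 * ‖ζ x‖ ^ 2 : ℝ) : ℂ) * h x) := by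
      rw [eq_neg_of_add_eq_zero_left h0, inner_neg_right, inner_smul_right,
        inner_self_eq_norm_sq_to_K]
      push_cast
      simp only [Complex.coe_algebraMap]
      ring
    have h2 := hre x
    rw [h1, Complex.neg_re, Complex.neg_im, Complex.re_ofReal_mul, Complex.im_ofReal_mul] at h2
    have h3 := hlow x
    rw [← Complex.normSq_eq_norm_sq, Complex.normSq_apply] at h3
    have h4 : 1 / 4 ≤ ‖ζ x‖ ^ 2 := by nlinarith
    have h5 : 1 / 20 ≤ ‖ζ x‖ ^ 2 * ((h x).re * (h x).re + (h x).im * (h x).im) := by nlinarith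
    have h6 := mul_le_mul_of_nonneg_left h5 (hs0 x).le
    linarith

/-- Over a second countable normal space of covering dimension at most one, a module of continuous
vector fields that is closed under uniform limits and has nonzero values everywhere contains a
nowhere vanishing vector field. -/
theorem exists_nowhere_vanishing [NormalSpace X] [SecondCountableTopology X]
    (hX : CoveringDimLE X 1) (F : HilbertField X E) (M : Submodule ℂ (∀ x, E x))
    (hMF : M ≤ F.sections)
    (hsmul : ∀ f : X → ℂ, Continuous f → ∀ ξ ∈ M, (fun x => f x • ξ x) ∈ M)
    (hlim : ∀ ξ : (∀ x, E x), (∀ ε : ℝ, 0 < ε → ∃ η ∈ M, ∀ y, ‖ξ y - η y‖ ≤ ε) → ξ ∈ M)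
    (hne : ∀ x, ∃ ξ ∈ M, ξ x ≠ 0) : ∃ ξ ∈ M, ∀ x, ξ x ≠ 0 := by
  rcases isEmpty_or_nonempty X with hemp | hnonemp
  · exact ⟨0, M.zero_mem, fun x => hemp.elim x⟩
  have hloc : ∀ x, ∃ ζ ∈ M, (∀ y, ‖ζ y‖ ≤ 1) ∧ ‖ζ x‖ = 1 := fun x => by
    obtain ⟨ξ, hξ, hx⟩ := hne x
    have hpos : 0 < ‖ξ x‖ := norm_pos_iff.2 hx
    -- Dividing by this maximum makes the norm 1 at x and at most 1 everywhere, without dividing by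
    -- zero.
    have hmax : ∀ y, 0 < max ‖ξ x‖ ‖ξ y‖ := fun y => lt_max_of_lt_left hpos
    have hnorm : ∀ y, ‖(((max ‖ξ x‖ ‖ξ y‖)⁻¹ : ℝ) : ℂ) • ξ y‖ = (max ‖ξ x‖ ‖ξ y‖)⁻¹ * ‖ξ y‖ :=
      fun y => by
        rw [norm_smul, Complex.norm_real, Real.norm_of_nonneg (inv_nonneg.2 (hmax y).le)]
    refine ⟨_, hsmul (fun y => (((max ‖ξ x‖ ‖ξ y‖)⁻¹ : ℝ) : ℂ))
      (Complex.continuous_ofReal.comp ((continuous_const.max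
        (F.continuous_norm ξ (hMF hξ))).inv₀ fun y => (hmax y).ne')) ξ hξ, fun y => ?_, ?_⟩
    · rw [hnorm, inv_mul_le_iff₀ (hmax y), mul_one]
      exact le_max_right _ _
    · rw [hnorm, max_self, inv_mul_cancel₀ hpos.ne']
  choose ζ' hζ'M hζ'1 hζ'x using hloc
  obtain ⟨t, htc, ht⟩ := TopologicalSpace.countable_cover_nhds
    (f := fun x => {y | 1 / 2 < ‖ζ' x y‖}) fun x =>
      (isOpen_lt continuous_const (F.continuous_norm _ (hMF (hζ'M x)))).mem_nhds
        (by rw [Set.mem_ofPred_eq, hζ'x]; norm_num)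
  have htne : t.Nonempty := by
    obtain ⟨x⟩ := hnonemp
    obtain ⟨y, hy, -⟩ := Set.mem_iUnion₂.1 (ht ▸ Set.mem_univ x)
    exact ⟨y, hy⟩
  obtain ⟨u, rfl⟩ := htc.exists_eq_range htne
  have hcov : ∀ x, ∃ k, 1 / 2 ≤ ‖ζ' (u k) x‖ := fun x => by
    obtain ⟨_, ⟨k, rfl⟩, hy⟩ := Set.mem_iUnion₂.1 (ht ▸ Set.mem_univ x)
    exact ⟨k, le_of_lt hy⟩
  set ζ : ℕ → ∀ x, E x := fun k => ζ' (u k)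
  have hζM : ∀ k, ζ k ∈ M := fun k => hζ'M _
  have hζ1 : ∀ k x, ‖ζ k x‖ ≤ 1 := fun k => hζ'1 _
  -- A state is an approximation together with a positive continuous tolerance that controls all
  -- later changes.
  let S := {p : (∀ x, E x) × (X → ℝ) // p.1 ∈ M ∧ Continuous p.2 ∧ ∀ x, 0 < p.2 x}
  have step : ∀ (k : ℕ) (p : S), ∃ p' : S, (∀ x, ‖p.1.1 x - p'.1.1 x‖ ≤ p.1.2 x / 4) ∧
      (∀ x, p'.1.2 x ≤ p.1.2 x / 4) ∧ ∀ x, 1 / 2 ≤ ‖ζ k x‖ → p'.1.2 x ≤ ‖p'.1.1 x‖ := by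
    rintro k ⟨⟨ξ, s⟩, hξ, hs, hs0⟩
    obtain ⟨g, hg, hgs, hg0⟩ := F.exists_perturbation hX (hMF hξ) (hMF (hζM k)) (hζ1 k) hs hs0
    have hξ' : (ξ + fun x => g x • ζ k x) ∈ M := M.add_mem hξ (hsmul g hg _ (hζM k))
    -- The term 1/2 - ‖ζ‖ keeps the tolerance positive where the new field may vanish; where ‖ζ‖ ≥
    -- 1/2 it is nonpositive and the norm of the new field is the bound.
    refine ⟨⟨⟨ξ + fun x => g x • ζ k x, fun x => min (s x / 4)
      (max ‖(ξ + fun x => g x • ζ k x) x‖ (1 / 2 - ‖ζ k x‖))⟩, hξ', ?_, fun x => ?_⟩,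
      fun x => ?_, fun x => min_le_left _ _, fun x hx => ?_⟩
    · exact (hs.div_const 4).min ((F.continuous_norm _ (hMF hξ')).max
        (continuous_const.sub (F.continuous_norm _ (hMF (hζM k)))))
    · refine lt_min (div_pos (hs0 x) (by norm_num)) (lt_max_iff.2 ?_)
      rcases le_or_gt (1 / 2) ‖ζ k x‖ with h | h
      · exact Or.inl (norm_pos_iff.2 (hg0 x h))
      · exact Or.inr (sub_pos.2 h)
    · simpa using hgs x
    · exact (min_le_right _ _).trans (max_le le_rfl ((sub_nonpos.2 hx).trans (norm_nonneg _)))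
  choose next hn1 hn2 hn3 using step
  let p : ℕ → S := fun k => Nat.rec ⟨⟨0, fun _ => 1⟩, M.zero_mem, continuous_const,
    fun _ => one_pos⟩ (fun k q => next k q) k
  have hp1 : ∀ k x, ‖(p k).1.1 x - (p (k + 1)).1.1 x‖ ≤ (p k).1.2 x / 4 := fun k => hn1 k (p k)
  have hp2 : ∀ k x, (p (k + 1)).1.2 x ≤ (p k).1.2 x / 4 := fun k => hn2 k (p k)
  have hp3 : ∀ k x, 1 / 2 ≤ ‖ζ k x‖ → (p (k + 1)).1.2 x ≤ ‖(p (k + 1)).1.1 x‖ :=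
    fun k => hn3 k (p k)
  have hs : ∀ k j x, (p (k + j)).1.2 x ≤ (p k).1.2 x * (1 / 4) ^ j := by
    intro k j x
    induction j with
    | zero => simp
    | succ j ih =>
      have := hp2 (k + j) x
      rw [← add_assoc, pow_succ]
      linarith
  have hd : ∀ k x j, dist ((p (k + j)).1.1 x) ((p (k + (j + 1))).1.1 x) ≤
      (p k).1.2 x / 4 * (1 / 4) ^ j := by
    intro k x j
    rw [dist_eq_norm, ← add_assoc]
    have h1 := hp1 (k + j) x
    have h2 := hs k j x
    linarith
  have hex : ∀ x, ∃ v, Filter.Tendsto (fun k => (p k).1.1 x) Filter.atTop (nhds v) := fun x => by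
    have := F.complete x
    refine cauchySeq_tendsto_of_complete (cauchySeq_of_le_geometric (1 / 4) (1 / 4) (by norm_num)
      fun k => ?_)
    simpa [p] using hd 0 x k
  choose ξ hξ using hex
  -- Geometric series: (s/4)/(1 - 1/4) = s/3. Being less than s, the total later change cannot
  -- cancel a value of norm at least s.
  have hbound : ∀ k x, ‖(p k).1.1 x - ξ x‖ ≤ (p k).1.2 x / 3 := fun k x => by
    have h := dist_le_of_le_geometric_of_tendsto₀ (1 / 4) ((p k).1.2 x / 4) (by norm_num)
      (hd k x) (a := ξ x) (by
        simpa only [add_comm] using (Filter.tendsto_add_atTop_iff_nat k).2 (hξ x))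
    rw [dist_eq_norm] at h
    refine h.trans_eq ?_
    norm_num
    ring
  refine ⟨ξ, hlim ξ fun ε hε => ?_, fun x hx => ?_⟩
  · obtain ⟨k, hk⟩ := exists_pow_lt_of_lt_one hε (show (1 / 4 : ℝ) < 1 by norm_num)
    refine ⟨(p k).1.1, (p k).2.1, fun y => ?_⟩
    rw [norm_sub_rev]
    have h1 := hs 0 k y
    have h2 : (p 0).1.2 y = 1 := rfl
    rw [zero_add, h2, one_mul] at h1
    have := hbound k y
    have := (p k).2.2.2 y
    linarith
  · obtain ⟨k, hk⟩ := hcov x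
    have h1 := hp3 k x hk
    have h2 := hbound (k + 1) x
    rw [hx, sub_zero] at h2
    have := (p (k + 1)).2.2.2 x
    linarith

/-! ### Orthonormal frames and trivial subfields -/

/-- The field has `n` continuous vector fields that are orthonormal at every point. -/
def HasOrthonormalFrame (F : HilbertField X E) (n : ℕ) : Prop :=
  ∃ e : Fin n → ∀ x, E x, (∀ i, e i ∈ F.sections) ∧ ∀ x, Orthonormal ℂ fun i => e i x

/-- Fields orthogonal to the frame form a closed module. It has a nonzero value at each point
because the frame spans a proper subspace there; a nowhere vanishing member is then normalized. -/
theorem exists_unit_orthogonal [NormalSpace X] [SecondCountableTopology X]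
    (hX : CoveringDimLE X 1) (F : HilbertField X E) {k : ℕ} (e : Fin k → ∀ x, E x)
    (he : ∀ i, e i ∈ F.sections) (ho : ∀ x, Orthonormal ℂ fun i => e i x)
    (hrank : ∀ x, (k : Cardinal) < Module.rank ℂ (E x)) :
    ∃ ξ ∈ F.sections, (∀ x, ‖ξ x‖ = 1) ∧ ∀ i x, inner ℂ (e i x) (ξ x) = 0 := by
  let M : Submodule ℂ (∀ x, E x) :=
    { carrier := {ξ | ξ ∈ F.sections ∧ ∀ i x, inner ℂ (e i x) (ξ x) = 0}
      add_mem' := fun ha hb => ⟨F.sections.add_mem ha.1 hb.1, fun i x => by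
        rw [Pi.add_apply, inner_add_right, ha.2, hb.2, add_zero]⟩
      zero_mem' := ⟨F.sections.zero_mem, fun i x => inner_zero_right _⟩
      smul_mem' := fun c _ ha => ⟨F.sections.smul_mem c ha.1, fun i x => by
        rw [Pi.smul_apply, inner_smul_right, ha.2, mul_zero]⟩ }
  obtain ⟨ξ, hξ, hne⟩ := F.exists_nowhere_vanishing hX M (fun ξ hξ => hξ.1)
    (fun f hf ξ hξ => ⟨F.smul_mem_sections hf hξ.1, fun i x => by
      rw [inner_smul_right, hξ.2, mul_zero]⟩)
    (fun ξ hξ => ⟨F.mem_of_locally_approx ξ fun x ε hε => by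
        obtain ⟨η, hη, h⟩ := hξ ε hε
        exact ⟨η, hη.1, Filter.Eventually.of_forall h⟩, fun i x => by
        refine norm_le_zero_iff.1 (le_of_forall_pos_le_add fun ε hε => ?_)
        obtain ⟨η, hη, h⟩ := hξ ε hε
        calc ‖inner ℂ (e i x) (ξ x)‖ = ‖inner ℂ (e i x) (ξ x - η x)‖ := by
              rw [inner_sub_right, hη.2, sub_zero]
          _ ≤ ‖e i x‖ * ‖ξ x - η x‖ := norm_inner_le_norm _ _
          _ ≤ 0 + ε := by
              rw [(ho x).norm_eq_one, one_mul, zero_add]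
              exact h x⟩)
    (fun x => by
      let K : Submodule ℂ (E x) := Submodule.span ℂ (Set.range fun i => e i x)
      have hfin : FiniteDimensional ℂ K := FiniteDimensional.span_of_finite ℂ (Set.finite_range _)
      have hK : K ≠ ⊤ := fun h => by
        have h1 : Module.rank ℂ K ≤ k := by
          rw [← Module.finrank_eq_rank ℂ K, Nat.cast_le]
          simpa [Set.finrank] using finrank_range_le_card (R := ℂ) fun i => e i x
        rw [h, rank_top] at h1
        exact (hrank x).not_ge h1
      obtain ⟨v, hvK, hv⟩ := (Submodule.ne_bot_iff _).1
        (mt Submodule.orthogonal_eq_bot_iff.1 hK)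
      obtain ⟨_, ⟨η, hη, rfl⟩, hd⟩ := (F.dense_values x).exists_dist_lt v (norm_pos_iff.2 hv)
      -- Gram–Schmidt applied to η. If the result vanished at x, η(x) would lie in K, hence at
      -- distance at least ‖v‖ from v ⟂ K.
      refine ⟨η - ∑ i, fun y => inner ℂ (e i y) (η y) • e i y,
        ⟨F.sections.sub_mem hη (F.sections.sum_mem fun i _ =>
          F.smul_mem_sections (F.continuous_inner (he i) hη) (he i)), fun i y => ?_⟩, fun h0 => ?_⟩
      · rw [Pi.sub_apply, Finset.sum_apply, inner_sub_right,
          (ho y).inner_right_sum _ (Finset.mem_univ i), sub_self]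
      · rw [Pi.sub_apply, Finset.sum_apply, sub_eq_zero] at h0
        have hηK : η x ∈ K := by
          rw [h0]
          exact K.sum_mem fun i _ => K.smul_mem _ (Submodule.subset_span ⟨i, rfl⟩)
        have h2 : ‖v‖ ^ 2 ≤ ‖v - η x‖ ^ 2 := by
          rw [@norm_sub_sq ℂ, (Submodule.mem_orthogonal' _ _).1 hvK _ hηK]
          simp
        rw [dist_eq_norm] at hd
        exact absurd (pow_lt_pow_left₀ hd (norm_nonneg _) two_ne_zero) h2.not_gt)
  refine ⟨_, F.smul_mem_sections (f := fun x => ((‖ξ x‖⁻¹ : ℝ) : ℂ))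
    (Complex.continuous_ofReal.comp ((F.continuous_norm ξ hξ.1).inv₀ fun x =>
      norm_ne_zero_iff.2 (hne x))) hξ.1, fun x => ?_, fun i x => ?_⟩
  · rw [norm_smul, Complex.norm_real, norm_inv, norm_norm,
      inv_mul_cancel₀ (norm_ne_zero_iff.2 (hne x))]
  · rw [inner_smul_right, hξ.2, mul_zero]

theorem hasOrthonormalFrame_of_le_rank [NormalSpace X] [SecondCountableTopology X]
    (hX : CoveringDimLE X 1) (F : HilbertField X E) (n : ℕ)
    (hrank : ∀ x, (n : Cardinal) ≤ Module.rank ℂ (E x)) : F.HasOrthonormalFrame n := by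
  induction n with
  | zero => exact ⟨fun i => i.elim0, fun i => i.elim0, fun x => orthonormal_iff_ite.2
      fun i => i.elim0⟩
  | succ k ih =>
    have hlt : ∀ x, (k : Cardinal) < Module.rank ℂ (E x) := fun x =>
      (Nat.cast_lt.2 k.lt_succ_self).trans_le (hrank x)
    obtain ⟨e, he, ho⟩ := ih fun x => (hlt x).le
    obtain ⟨ξ, hξ, h1, h0⟩ := F.exists_unit_orthogonal hX e he ho hlt
    refine ⟨Fin.cons ξ e, fun i => ?_, fun x => orthonormal_iff_ite.2 fun i j => ?_⟩
    · refine Fin.cases ?_ (fun i => ?_) i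
      exacts [hξ, he i]
    · refine Fin.cases ?_ (fun i => ?_) i <;> refine Fin.cases ?_ (fun j => ?_) j
      · simp [inner_self_eq_norm_sq_to_K, h1]
      · rw [if_neg (Fin.succ_ne_zero j).symm]
        exact inner_eq_zero_symm.1 (h0 j x)
      · rw [if_neg (Fin.succ_ne_zero i)]
        exact h0 i x
      · simpa using orthonormal_iff_ite.1 (ho x) i j

/-- The orthonormal basis of its span defined by an orthonormal family. -/
noncomputable def spanBasis {n : ℕ} {K : Type*} [NormedAddCommGroup K] [InnerProductSpace ℂ K]
    {e : Fin n → K} (ho : Orthonormal ℂ e) :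
    OrthonormalBasis (Fin n) ℂ (Submodule.span ℂ (Set.range e)) :=
  (Module.Basis.span ho.linearIndependent).toOrthonormalBasis (by
    rw [orthonormal_iff_ite]
    intro i j
    rw [Submodule.coe_inner, Module.Basis.span_apply, Module.Basis.span_apply]
    exact orthonormal_iff_ite.1 ho i j)

theorem coe_spanBasis {n : ℕ} {K : Type*} [NormedAddCommGroup K] [InnerProductSpace ℂ K]
    {e : Fin n → K} (ho : Orthonormal ℂ e) (i : Fin n) : (spanBasis ho i : K) = e i := by
  rw [spanBasis, Module.Basis.coe_toOrthonormalBasis, Module.Basis.span_apply]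

theorem spanBasis_repr {n : ℕ} {K : Type*} [NormedAddCommGroup K] [InnerProductSpace ℂ K]
    {e : Fin n → K} (ho : Orthonormal ℂ e) (v : Submodule.span ℂ (Set.range e)) :
    (spanBasis ho).repr v = WithLp.toLp 2 fun i => inner ℂ (e i) (v : K) := by
  ext i
  rw [OrthonormalBasis.repr_apply_apply, Submodule.coe_inner, coe_spanBasis]

theorem sum_spanBasis_repr {n : ℕ} {K : Type*} [NormedAddCommGroup K] [InnerProductSpace ℂ K]
    {e : Fin n → K} (ho : Orthonormal ℂ e) (v : Submodule.span ℂ (Set.range e)) :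
    (v : K) = ∑ i, (spanBasis ho).repr v i • e i := by
  conv_lhs => rw [← (spanBasis ho).sum_repr v]
  simp [coe_spanBasis]

/-- The subfield spanned by continuous vector fields that are orthonormal at every point. -/
noncomputable def spanSubfield (F : HilbertField X E) {n : ℕ} (e : Fin n → ∀ x, E x)
    (he : ∀ i, e i ∈ F.sections) : F.SubHilbertField where
  fiber x := Submodule.span ℂ (Set.range fun i => e i x)
  field :=
    { complete := fun x => by
        have := FiniteDimensional.span_of_finite ℂ (Set.finite_range fun i => e i x)
        exact FiniteDimensional.complete ℂ _
      sections :=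
        { carrier := {ξ | (fun x => (ξ x : E x)) ∈ F.sections}
          add_mem' := fun ha hb => F.sections.add_mem ha hb
          zero_mem' := F.sections.zero_mem
          smul_mem' := fun c _ ha => F.sections.smul_mem c ha }
      continuous_norm := fun ξ hξ => F.continuous_norm _ hξ
      dense_values := fun x => by
        refine dense_univ.mono ?_
        rintro ⟨v, hv⟩ -
        obtain ⟨c, rfl⟩ := (Submodule.mem_span_range_iff_exists_fun ℂ).1 hv
        refine ⟨fun y => ⟨∑ i, c i • e i y, Submodule.sum_mem _ fun i _ =>
          Submodule.smul_mem _ _ (Submodule.subset_span ⟨i, rfl⟩)⟩, ?_, rfl⟩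
        have hsum : (fun y => ∑ i, c i • e i y) = ∑ i, c i • e i := by
          ext y
          simp
        change (fun y => ∑ i, c i • e i y) ∈ F.sections
        rw [hsum]
        exact F.sections.sum_mem fun i _ => F.sections.smul_mem _ (he i)
      mem_of_locally_approx := fun ξ h => F.mem_of_locally_approx _ fun x ε hε => by
        obtain ⟨η, hη, hx⟩ := h x ε hε
        exact ⟨fun y => (η y : E y), hη, hx⟩ }
  sections_subset _ hξ := hξ

/-- Coordinates in the frame are inner products with it, so a field in its span is continuous
exactly when its coordinates are. -/
theorem HasOrthonormalFrame.hasTrivialSubfield {F : HilbertField X E} {n : ℕ}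
    (h : F.HasOrthonormalFrame n) : F.HasTrivialSubfield n := by
  obtain ⟨e, he, ho⟩ := h
  refine ⟨F.spanSubfield e he, fun x => (spanBasis (ho x)).repr, fun ξ => ⟨fun hξ => ?_,
    fun hξ => ?_⟩⟩
  · change Continuous fun x => (spanBasis (ho x)).repr (ξ x)
    have hc : Continuous fun x => WithLp.toLp 2 fun i => inner ℂ (e i x) (ξ x : E x) :=
      (PiLp.continuous_toLp 2 _).comp (continuous_pi fun i => F.continuous_inner (he i) hξ)
    exact hc.congr fun x => (spanBasis_repr (ho x) (ξ x)).symm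
  · change (fun x => (ξ x : E x)) ∈ F.sections
    have hξ' : Continuous fun x => (spanBasis (ho x)).repr (ξ x) := hξ
    have hsum : ∑ i, (fun x => (spanBasis (ho x)).repr (ξ x) i • e i x) ∈ F.sections :=
      F.sections.sum_mem fun i _ => F.smul_mem_sections
        ((EuclideanSpace.proj (𝕜 := ℂ) i).continuous.comp hξ') (he i)
    have heq : (fun x => (ξ x : E x)) =
        ∑ i, (fun x => (spanBasis (ho x)).repr (ξ x) i • e i x) := by
      ext x
      rw [Finset.sum_apply]
      exact sum_spanBasis_repr (ho x) (ξ x)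
    rw [heq]
    exact hsum

theorem HasTrivialSubfield.hasOrthonormalFrame {F : HilbertField X E} {n : ℕ}
    (h : F.HasTrivialSubfield n) : F.HasOrthonormalFrame n := by
  obtain ⟨S, φ, hφ⟩ := h
  refine ⟨fun i x => (φ x).symm (EuclideanSpace.single i 1), fun i => S.sections_subset _ ?_,
    fun x => ?_⟩
  · rw [hφ]
    simp only [LinearIsometryEquiv.apply_symm_apply]
    exact continuous_const
  · have h1 : Orthonormal ℂ fun i => (φ x).symm (EuclideanSpace.single i 1) :=
      (EuclideanSpace.orthonormal_single (𝕜 := ℂ)).comp_linearIsometryEquiv (φ x).symm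
    exact h1.comp_linearIsometry (S.fiber x).subtypeₗᵢ

end

end HilbertField

/-! ### Projection-valued functions -/

theorem IsStarProjection.le_iff_range_le {H : Type*} [NormedAddCommGroup H]
    [InnerProductSpace ℂ H] [CompleteSpace H] {p q : H →L[ℂ] H} (hp : IsStarProjection p)
    (hq : IsStarProjection q) : p ≤ q ↔ p.range ≤ q.range := by
  obtain ⟨hp', hp⟩ := isStarProjection_iff_eq_starProjection_range.1 hp
  obtain ⟨hq', hq⟩ := isStarProjection_iff_eq_starProjection_range.1 hq
  conv_lhs => rw [hp, hq]
  exact Submodule.starProjection_le_starProjection_iff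

theorem HilbertField.HasOrthonormalFrame.exists_projection {X : Type*} [TopologicalSpace X]
    {H : Type*} [NormedAddCommGroup H] [InnerProductSpace ℂ H] [CompleteSpace H]
    {p : X → H →L[ℂ] H} {hp : ∀ x, IsStarProjection (p x)}
    {hcont : ∀ v : H, Continuous fun x => p x v} {n : ℕ}
    (h : (HilbertField.ofProjection p hp hcont).HasOrthonormalFrame n) :
    ∃ q : X → H →L[ℂ] H, Continuous q ∧ (∀ x, IsStarProjection (q x)) ∧
      (∀ x, q x ≤ p x) ∧ ∀ x, Module.rank ℂ (q x).range = n := by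
  obtain ⟨e, he, ho⟩ := h
  have hec : ∀ i, Continuous fun x => (e i x : H) := he
  have hoH : ∀ x, Orthonormal ℂ fun i => (e i x : H) := fun x =>
    (ho x).comp_linearIsometry (p x).range.subtypeₗᵢ
  have hfin : ∀ x, FiniteDimensional ℂ (Submodule.span ℂ (Set.range fun i => (e i x : H))) :=
    fun x => FiniteDimensional.span_of_finite ℂ (Set.finite_range _)
  have hproj : ∀ x, IsStarProjection
      (Submodule.span ℂ (Set.range fun i => (e i x : H))).starProjection := fun x =>
    isStarProjection_starProjection
  refine ⟨fun x => (Submodule.span ℂ (Set.range fun i => (e i x : H))).starProjection, ?_, hproj,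
    fun x => ((hproj x).le_iff_range_le (hp x)).2 ?_, fun x => ?_⟩
  · simp only [(HilbertField.spanBasis (hoH _)).starProjection_eq_sum_rankOne,
      HilbertField.coe_spanBasis]
    -- Each rank-one operator depends norm continuously on its vector, hence so does the finite sum.
    refine continuous_finsetSum _ fun i _ => ?_
    exact ((ContinuousLinearMap.smulRightL ℂ H H).continuous.comp
      ((innerSL ℂ).continuous.comp (hec i))).clm_apply (hec i)
  · rw [Submodule.range_starProjection, Submodule.span_le]
    rintro _ ⟨i, rfl⟩
    exact (e i x).2
  · rw [Submodule.range_starProjection, ← Module.finrank_eq_rank,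
      finrank_span_eq_card (hoH x).linearIndependent, Fintype.card_fin]

theorem mainTheorem9 {X : Type*} [MetricSpace X] [TopologicalSpace.SeparableSpace X]
    (hX : CoveringDimLE X 1) (n : ℕ) :
    (∀ (E : X → Type*) [∀ x, NormedAddCommGroup (E x)] [∀ x, InnerProductSpace ℂ (E x)]
        (F : HilbertField X E), (∀ x, (n : Cardinal) ≤ Module.rank ℂ (E x)) →
        F.HasTrivialSubfield n) ∧
    (∀ (H : Type*) [NormedAddCommGroup H] [InnerProductSpace ℂ H] [CompleteSpace H]
        (p : X → H →L[ℂ] H) (hp : ∀ x, IsStarProjection (p x))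
        (hcont : ∀ v : H, Continuous fun x => p x v),
        ((∀ x, (n : Cardinal) ≤ Module.rank ℂ (p x).range) →
          ∃ q : X → H →L[ℂ] H, Continuous q ∧ (∀ x, IsStarProjection (q x)) ∧
            (∀ x, q x ≤ p x) ∧ ∀ x, Module.rank ℂ (q x).range = n) ∧
        ((HilbertField.ofProjection p hp hcont).HasTrivialSubfield n ↔
          ∃ q : X → H →L[ℂ] H, Continuous q ∧ (∀ x, IsStarProjection (q x)) ∧
            (∀ x, q x ≤ p x) ∧ ∀ x, Module.rank ℂ (q x).range = n)) := by
  have : SecondCountableTopology X := UniformSpace.secondCountable_of_separable X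
  refine ⟨fun E _ _ F hF => (F.hasOrthonormalFrame_of_le_rank hX n hF).hasTrivialSubfield,
    fun H _ _ _ p hp hcont => ⟨fun hrank => ?_, fun h => ?_, ?_⟩⟩
  · exact ((HilbertField.ofProjection p hp hcont).hasOrthonormalFrame_of_le_rank hX n
      hrank).exists_projection
  · exact h.hasOrthonormalFrame.exists_projection
  -- A subprojection of rank n forces rank p(x) ≥ n, so the existence result for frames applies to
  -- the field of p.
  · rintro ⟨q, -, hq, hqp, hqn⟩
    refine ((HilbertField.ofProjection p hp hcont).hasOrthonormalFrame_of_le_rank hX n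
      fun x => ?_).hasTrivialSubfield
    rw [← hqn x]
    exact Submodule.rank_mono (((hq x).le_iff_range_le (hp x)).1 (hqp x))
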